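/- All rings are associative with $1$. Let $R$ be a ring. Conventions. The set of left regular elements of $R$ is ${}'\mathcal C_R=\{r\in R : xr=0\Rightarrow x=0 \text{ for all } x\in R\}$, and $\mathcal C_R=\{r\in {}'\mathcal C_R : rx=0\Rightarrow x=0 \text{ for all } x\in R\}$ is the set of regular elements. A multiplicative set in $R$ is a subset $S$ with $1\in S$, $SS\subseteq S$ and $0\notin S$. A left denominator set of $R$ is a multiplicative set $S$ such that for all $r\in R$, $s\in S$ one has $Sr\cap Rs\neq\emptyset$, and such that $rs=0$ with $r\in R$, $s\in S$ implies $tr=0$ for some $t\in S$; then the ring of left fractions $S^{-1}R$ exists. If $S\subseteq T$ are multiplicative sets in $R$, then $S$ is called dense in $T$ if for each $t\in T$ there is $r\in R$ with $rt\in S$. Put $$\mathfrak a:=\{r\in R : cr=0 \text{ for some } c\in {}'\mathcal C_R\}.$$ When $\mathfrak a$ is an ideal, let $\pi:R\to R/\mathfrak a$ be the quotient map. "Ideal" means two-sided ideal. An ideal $\mathfrak p\neq R$ is prime if $IJ\subseteq\mathfrak p$ implies $I\subseteq\mathfrak p$ or $J\subseteq\mathfrak p$ for all ideals $I,J$; an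 ideal $\mathfrak b$ is semiprime if $I^2\subseteq\mathfrak b$ implies $I\subseteq\mathfrak b$ for all ideals $I$; $\operatorname{Min}_R(\mathfrak a)$ is the set of minimal elements, with respect to inclusion, among the prime ideals containing $\mathfrak a$. A ring is left Goldie if it satisfies the ascending chain condition on left annihilators (left ideals of the form $\{r : rX=0\}$ with $X$ a subset) and has finite left uniform dimension, that is, some finite direct sum of uniform left ideals is an essential left ideal. We say that ${}'Q_{l,cl}(R)$ is a semisimple Artinian ring if ${}'\mathcal C_R$ is a left denominator set of $R$ and the ring ${}'Q_{l,cl}(R):={}'\mathcal C_R^{-1}R$ is semisimple Artinian. Theorem. The following statements are equivalent. 1. ${}'Q_{l,cl}(R)$ is a semisimple Artinian ring. 2. (a) $\mathfrak a$ is a semiprime ideal of $R$ and the set $\operatorname{Min}_R(\mathfrak a)$ is finite; (b) for each $\mathfrak p\in\operatorname{Min}_R(\mathfrak a)$, the ring $R/\mathfrak p$ is a left Goldie ring; (c) the set $\pi({}'\mathcal C_R)$ is a dense subset of $\mathcal C_{R/\mathfrak a}$ (in particular, $\pi({}'\mathcal C_R)\subseteq\mathcal C_{R/\mathfrak a}$).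 -/

import Mathlib

namespace LeftQuot

/-! ### Left denominator sets and left quotient rings

The monoid of left regular elements of `R`, that is of the `r` such that `x ↦ x * r` is injective,
is Mathlib's `nonZeroDivisorsRight R`; the monoid of regular elements is `nonZeroDivisors R`. -/

section Localization

variable {R : Type*} [Ring R]

/-- A left denominator set of `R`: a multiplicative set (`1 ∈ S`, `S S ⊆ S`, `0 ∉ S`) that satisfies
the left Ore condition and is left reversible. -/
structure IsLeftDenominatorSet (S : Submonoid R) : Prop where
  zero_notMem : (0 : R) ∉ S
  ore : ∀ r : R, ∀ s ∈ S, ∃ r' : R, ∃ s' ∈ S, s' * r = r' * s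
  reversible : ∀ r : R, ∀ s ∈ S, r * s = 0 → ∃ t ∈ S, t * r = 0

theorem IsLeftDenominatorSet.nonempty_oreSet {S : Submonoid R} (h : IsLeftDenominatorSet S) :
    Nonempty (OreLocalization.OreSet S) := by
  refine OreLocalization.nonempty_oreSet_iff.2 ⟨fun r₁ r₂ s hs => ?_, fun r s => ?_⟩
  · obtain ⟨t, ht, h0⟩ := h.reversible (r₁ - r₂) s s.2 (by rw [sub_mul, hs, sub_self])
    exact ⟨⟨t, ht⟩, sub_eq_zero.1 (by rw [← mul_sub]; exact h0)⟩
  · obtain ⟨r', s', hs', e⟩ := h.ore r s s.2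
    exact ⟨r', ⟨s', hs'⟩, e⟩

/-- The Ore data of a left denominator set. The ring of left fractions does not depend on them up to
a unique isomorphism over `R`. -/
noncomputable abbrev IsLeftDenominatorSet.oreSet {S : Submonoid R} (h : IsLeftDenominatorSet S) :
    OreLocalization.OreSet S :=
  h.nonempty_oreSet.some

/-- The left quotient ring `S⁻¹R` at a left denominator set `S`. -/
def LeftQuotientRing {S : Submonoid R} (h : IsLeftDenominatorSet S) : Type _ :=
  letI := h.oreSet
  OreLocalization S R

noncomputable instance {S : Submonoid R} (h : IsLeftDenominatorSet S) :
    Ring (LeftQuotientRing h) :=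
  letI := h.oreSet
  inferInstanceAs (Ring (OreLocalization S R))

/-- `ass_R(S)`, the set of the `r` such that `s r = 0` for some `s ∈ S`. -/
def ass (S : Submonoid R) : Set R :=
  {r | ∃ s ∈ S, s * r = 0}

/-- For multiplicative sets `S` and `T` of `R`: `S` is a (left) dense subset of `T`. -/
structure IsDenseSubset (S T : Submonoid R) : Prop where
  zero_notMem_left : (0 : R) ∉ S
  zero_notMem_right : (0 : R) ∉ T
  le : S ≤ T
  dense : ∀ t ∈ T, ∃ r : R, r * t ∈ S

end Localization

/-! ### Prime and semiprime ideals of noncommutative rings -/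

section Primes

variable {R : Type*} [Ring R]

/-- `P` is a prime ideal: it is proper, and `A B ⊆ P` implies `A ⊆ P` or `B ⊆ P` for all
(two-sided) ideals `A` and `B`. -/
structure IsPrimeIdeal (P : TwoSidedIdeal R) : Prop where
  ne_top : P ≠ ⊤
  le_or_le : ∀ A B : TwoSidedIdeal R, (∀ a ∈ A, ∀ b ∈ B, a * b ∈ P) → A ≤ P ∨ B ≤ P

/-- `I` is a semiprime ideal: `A A ⊆ I` implies `A ⊆ I` for all (two-sided) ideals `A`. -/
def IsSemiprimeIdeal (I : TwoSidedIdeal R) : Prop :=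
  ∀ A : TwoSidedIdeal R, (∀ a ∈ A, ∀ b ∈ A, a * b ∈ I) → A ≤ I

/-- The set `Min_R(I)` of minimal primes over `I`. -/
def minPrimes (I : TwoSidedIdeal R) : Set (TwoSidedIdeal R) :=
  {P | Minimal (fun Q => IsPrimeIdeal Q ∧ I ≤ Q) P}

end Primes

/-! ### Left Goldie rings

In a noncommutative ring `R`, `Ideal R` is the type of left ideals. -/

section Goldie

variable {R : Type*} [Ring R]

/-- `J` is an essential left ideal. -/
def IsEssentialLeftIdeal (J : Ideal R) : Prop :=
  ∀ K : Ideal R, K ≠ ⊥ → J ⊓ K ≠ ⊥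

/-- `U` is a uniform left ideal: it is nonzero and any two nonzero left ideals inside it meet
nontrivially. -/
structure IsUniformLeftIdeal (U : Ideal R) : Prop where
  ne_bot : U ≠ ⊥
  inf_ne_bot : ∀ K L : Ideal R, K ≤ U → L ≤ U → K ≠ ⊥ → L ≠ ⊥ → K ⊓ L ≠ ⊥

/-- `I` is a left annihilator: `I = {r | r X = 0}` for some subset `X` of `R`. -/
def IsLeftAnnihilator (I : Ideal R) : Prop :=
  ∃ X : Set R, ∀ r : R, r ∈ I ↔ ∀ x ∈ X, r * x = 0

variable (R)

/-- The left uniform dimension of `R` is finite: some finite direct sum of uniform left ideals is an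
essential left ideal. -/
def FiniteLeftUniformDim : Prop :=
  ∃ (n : ℕ) (U : Fin n → Ideal R),
    (∀ i, IsUniformLeftIdeal (U i)) ∧ iSupIndep U ∧ IsEssentialLeftIdeal (⨆ i, U i)

/-- The ascending chain condition on left annihilators. -/
def ACCLeftAnnihilators : Prop :=
  ∀ f : ℕ →o Ideal R, (∀ n, IsLeftAnnihilator (f n)) → ∃ n, ∀ m, n ≤ m → f n = f m

/-- `R` is a left Goldie ring. -/
structure IsLeftGoldie : Prop where
  acc : ACCLeftAnnihilators R
  udim : FiniteLeftUniformDim R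

end Goldie

end LeftQuot

/-! Both directions work with a ring map `φ : R → Q` that inverts `S` and for which every element of
`Q` is a left fraction (`IsLeftOrder`); for `Q = S⁻¹R` its kernel is `ass S`.

If `Q` is semisimple, Wedderburn–Artin projects it onto finitely many simple Artinian rings. The
kernels of the composites `R → Q → Qᵢ` are prime with left Goldie quotients, and they intersect in
`ker φ`, so every minimal prime over `ker φ` is one of them
(`isGoldieSemiprime_ker_of_isLeftOrder`). Density holds because an injective right multiplication on
the Artinian ring `Q` is surjective: an element regular modulo `ker φ` has a left inverse in `Q`,
whose denominator can be cleared.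

Conversely, Goldie's lemma gives regular elements modulo each minimal prime. They are glued into one
element regular modulo `a` (`IsGoldieSemiprime.exists_mem_regular`), which yields the Ore condition
modulo `a`. Density replaces regular elements by images of left regular ones, and `a = ass S` lets
one more factor from `S` turn congruences into equalities. Then every left ideal of `R` that is
essential modulo `a` meets `S`, so `Q` has no proper essential left ideal and is semisimple. -/

namespace LeftQuot

/-! ### Uniform dimension, nonsingularity and Goldie's lemma. -/

section GoldieTheory

variable {R : Type*} [Ring R]

theorem isEssentialLeftIdeal_iff {E : Ideal R} :
    IsEssentialLeftIdeal E ↔ ∀ x : R, x ≠ 0 → ∃ r : R, r * x ∈ E ∧ r * x ≠ 0 := by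
  constructor
  · intro h x hx
    have hK : Ideal.span {x} ≠ ⊥ := by simpa using hx
    obtain ⟨y, hy, hy0⟩ := Submodule.exists_mem_ne_zero_of_ne_bot (h _ hK)
    obtain ⟨hyE, hyx⟩ := Submodule.mem_inf.1 hy
    obtain ⟨r, rfl⟩ := Ideal.mem_span_singleton'.1 hyx
    exact ⟨r, hyE, hy0⟩
  · intro h K hK hbot
    obtain ⟨x, hx, hx0⟩ := Submodule.exists_mem_ne_zero_of_ne_bot hK
    obtain ⟨r, hr, hr0⟩ := h x hx0
    have : r * x ∈ E ⊓ K := ⟨hr, K.mul_mem_left r hx⟩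
    rw [hbot] at this
    exact hr0 (by simpa using this)

theorem IsUniformLeftIdeal.exists_mul_mem {U N : Ideal R} (hU : IsUniformLeftIdeal U)
    (hN : N ⊓ U ≠ ⊥) {u : R} (hu : u ∈ U) (hu0 : u ≠ 0) : ∃ r : R, r * u ∈ N ∧ r * u ≠ 0 := by
  have hle : Ideal.span {u} ≤ U := by simpa [Ideal.span_le] using hu
  have hne : Ideal.span {u} ≠ ⊥ := by simpa using hu0
  obtain ⟨y, hy, hy0⟩ := Submodule.exists_mem_ne_zero_of_ne_bot
    (hU.inf_ne_bot (N ⊓ U) _ inf_le_right hle hN hne)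
  obtain ⟨r, rfl⟩ := Ideal.mem_span_singleton'.1 hy.2
  exact ⟨r, hy.1.1, hy0⟩

theorem _root_.iSupIndep.disjoint_finset_sup {ι : Type*} {U : ι → Ideal R} (hU : iSupIndep U)
    {i : ι} {I : Finset ι} (hi : i ∉ I) : Disjoint (U i) (I.sup U) := by
  refine (hU i).mono_right (Finset.sup_le fun j hj => ?_)
  exact le_iSup₂_of_le j (fun h => hi (h ▸ hj)) le_rfl

/-- A multiplier first moves one component into `N`, and a second then moves the rest; independence
prevents the two parts from cancelling. -/
theorem exists_mul_mem_of_mem_finset_sup {ι : Type*} {U : ι → Ideal R}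
    (hU : ∀ i, IsUniformLeftIdeal (U i)) (hind : iSupIndep U) {N : Ideal R}
    (hN : ∀ i, N ⊓ U i ≠ ⊥) (I : Finset ι) :
    ∀ x ∈ I.sup U, x ≠ 0 → ∃ r : R, r * x ∈ N ∧ r * x ≠ 0 := by
  classical
  induction I using Finset.induction_on with
  | empty => intro x hx hx0; exact absurd (by simpa using hx) hx0
  | insert i I hi ih =>
    intro x hx hx0
    rw [Finset.sup_insert] at hx
    obtain ⟨u, hu, v, hv, rfl⟩ := Submodule.mem_sup.1 hx
    by_cases hu0 : u = 0
    · subst hu0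
      rw [zero_add] at hx0 ⊢
      exact ih v hv hx0
    obtain ⟨r, hrN, hr0⟩ := (hU i).exists_mul_mem (hN i) hu hu0
    by_cases hrv : r * v = 0
    · exact ⟨r, by rwa [mul_add, hrv, add_zero], by rwa [mul_add, hrv, add_zero]⟩
    obtain ⟨t, htN, ht0⟩ := ih (r * v) (Ideal.mul_mem_left _ r hv) hrv
    refine ⟨t * r, ?_, fun h => ht0 ?_⟩
    · rw [mul_add, mul_assoc, mul_assoc]
      exact N.add_mem (N.mul_mem_left t hrN) htN
    · rw [mul_add, mul_assoc, mul_assoc] at h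
      refine (Submodule.disjoint_def.1 (hind.disjoint_finset_sup hi)) _ ?_
        (Ideal.mul_mem_left _ t (Ideal.mul_mem_left _ r hv))
      rw [← neg_eq_of_add_eq_zero_right h]
      exact neg_mem (Ideal.mul_mem_left _ t (Ideal.mul_mem_left _ r hu))

/-- Finite left uniform dimension yields a monotone `ℕ`-valued size function on left ideals that
strictly increases along inclusions that are not essential. -/
theorem FiniteLeftUniformDim.exists_size (h : FiniteLeftUniformDim R) :
    ∃ δ : Ideal R → ℕ, ∀ K K' V : Ideal R, K ≤ K' → V ≤ K' → V ≠ ⊥ → Disjoint V K →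
      δ K < δ K' := by
  classical
  obtain ⟨n, U, hU, hind, hess⟩ := h
  -- The size of `K` is the number of index sets `I` for which `K` meets the sum of the `U i` with
  -- `i ∈ I`.
  refine ⟨fun K => (Finset.univ.filter fun I : Finset (Fin n) => ¬ Disjoint K (I.sup U)).card,
    fun K K' V hK hV hV0 hVK => Finset.card_lt_card ?_⟩
  refine (Finset.ssubset_iff_of_subset fun I hI => ?_).2 ?_
  · simp only [Finset.mem_filter, Finset.mem_univ, true_and] at hI ⊢
    exact fun hd => hI (hd.mono_left hK)
  simp only [Finset.mem_filter, Finset.mem_univ, true_and, not_not]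
  by_contra! hcon
  -- If the count did not grow, `K` and `K'` would be disjoint from the same partial sums. For a
  -- maximal such sum, `K ⊔ I.sup U` meets every `U i`, hence meets `V`; since `K'` is disjoint from
  -- `I.sup U`, the common element lies in `K`, contradicting `Disjoint V K`.
  obtain ⟨I, hI⟩ := (Set.toFinite {I : Finset (Fin n) | Disjoint K' (I.sup U)}).exists_maximal
    ⟨∅, by simp⟩
  have hKI : Disjoint K' (I.sup U) := hI.1
  have hmeet : ∀ i, (K ⊔ I.sup U) ⊓ U i ≠ ⊥ := by
    intro i
    by_cases hi : i ∈ I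
    · have hle : U i ≤ K ⊔ I.sup U := (Finset.le_sup hi).trans le_sup_right
      rw [inf_eq_right.2 hle]
      exact (hU i).ne_bot
    have h1 : ¬ Disjoint K ((insert i I).sup U) := by
      intro hd
      by_contra
      have h2 : Disjoint K' ((insert i I).sup U) := by
        by_contra h3
        exact h3 (by_contra fun h4 => hcon _ h4 hd)
      exact hi (hI.2 h2 (Finset.subset_insert i I) (Finset.mem_insert_self i I))
    rw [disjoint_iff] at h1
    obtain ⟨k, hk, hk0⟩ := Submodule.exists_mem_ne_zero_of_ne_bot h1
    obtain ⟨hkK, hks⟩ := Submodule.mem_inf.1 hk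
    rw [Finset.sup_insert] at hks
    obtain ⟨u, hu, v, hv, rfl⟩ := Submodule.mem_sup.1 hks
    refine (Submodule.ne_bot_iff _).2 ⟨u, ⟨?_, hu⟩, fun hu0 => hk0 ?_⟩
    · have : u = (u + v) - v := by abel
      rw [this]
      exact sub_mem (Submodule.mem_sup_left hkK) (Submodule.mem_sup_right hv)
    · subst hu0
      rw [zero_add] at hkK ⊢
      exact Submodule.disjoint_def.1 hKI v (hK hkK) hv
  obtain ⟨x, hx, hx0⟩ := Submodule.exists_mem_ne_zero_of_ne_bot (hess V hV0)
  obtain ⟨hxU, hxV⟩ := Submodule.mem_inf.1 hx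
  rw [← Finset.sup_univ_eq_iSup] at hxU
  obtain ⟨r, hr, hr0⟩ := exists_mul_mem_of_mem_finset_sup hU hind hmeet _ x hxU hx0
  obtain ⟨k, hk, u, hu, e⟩ := Submodule.mem_sup.1 hr
  have hrV : r * x ∈ V := V.mul_mem_left r hxV
  have hu0 : u = 0 := by
    refine Submodule.disjoint_def.1 hKI u ?_ hu
    have : u = r * x - k := by rw [← e]; abel
    rw [this]
    exact sub_mem (hV hrV) (hK hk)
  rw [hu0, add_zero] at e
  exact hr0 (Submodule.disjoint_def.1 hVK _ hrV (e ▸ hk))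

theorem FiniteLeftUniformDim.exists_isUniformLeftIdeal_le (h : FiniteLeftUniformDim R)
    {K : Ideal R} (hK : K ≠ ⊥) : ∃ U ≤ K, IsUniformLeftIdeal U := by
  obtain ⟨δ, hδ⟩ := h.exists_size
  obtain ⟨U, ⟨hUK, hU0⟩, hmin⟩ := WellFounded.has_min (InvImage.wf δ Nat.lt_wfRel.wf)
    {U : Ideal R | U ≤ K ∧ U ≠ ⊥} ⟨K, le_rfl, hK⟩
  refine ⟨U, hUK, hU0, fun A B hA hB hA0 hB0 hAB => ?_⟩
  exact hmin A ⟨hA.trans hUK, hA0⟩ (hδ A U B hA hB hB0 (disjoint_iff.2 (by rwa [inf_comm])))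

/-- The left annihilator of an element. -/
def leftAnn (x : R) : Ideal R :=
  LinearMap.ker (LinearMap.toSpanSingleton R R x)

theorem mem_leftAnn {x y : R} : y ∈ leftAnn x ↔ y * x = 0 := by
  simp [leftAnn]

theorem isLeftAnnihilator_leftAnn (x : R) : IsLeftAnnihilator (leftAnn x) :=
  ⟨{x}, fun r => by simp [mem_leftAnn]⟩

theorem isEssentialLeftIdeal_mono {E F : Ideal R} (hE : IsEssentialLeftIdeal E) (h : E ≤ F) :
    IsEssentialLeftIdeal F := fun K hK hb => hE K hK (eq_bot_mono (inf_le_inf_right K h) hb)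

theorem ACCLeftAnnihilators.exists_maximal (h : ACCLeftAnnihilators R) {s : Set R}
    (hs : s.Nonempty) : ∃ z ∈ s, ∀ w ∈ s, leftAnn z ≤ leftAnn w → leftAnn w ≤ leftAnn z := by
  have hwf : WellFoundedGT {I : Ideal R // IsLeftAnnihilator I} := by
    rw [wellFoundedGT_iff_monotone_chain_condition]
    intro f
    obtain ⟨n, hn⟩ := h ⟨fun k => (f k).1, fun i j hij => f.2 hij⟩ fun k => (f k).2
    exact ⟨n, fun m hm => Subtype.ext (hn m hm)⟩
  obtain ⟨z, hz, hmin⟩ := WellFounded.has_min (InvImage.wf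
    (fun x : R => (⟨leftAnn x, isLeftAnnihilator_leftAnn x⟩ : {I : Ideal R // IsLeftAnnihilator I}))
    hwf.wf) s hs
  refine ⟨z, hz, fun w hw hle => ?_⟩
  by_contra hnot
  exact hmin w hw (lt_of_le_not_ge hle hnot)

/-- A semiprime ring with the ascending chain condition on left annihilators is left nonsingular. -/
theorem ACCLeftAnnihilators.eq_zero_of_isEssential (h : ACCLeftAnnihilators R)
    (hs : ∀ a : R, (∀ r, a * r * a = 0) → a = 0) {x : R}
    (hx : IsEssentialLeftIdeal (leftAnn x)) : x = 0 := by
  by_contra hx0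
  obtain ⟨z, ⟨hz, hz0⟩, hmax⟩ := h.exists_maximal
    (s := {z : R | IsEssentialLeftIdeal (leftAnn z) ∧ z ≠ 0}) ⟨x, hx, hx0⟩
  refine hz0 (hs z fun r => ?_)
  by_contra hne
  have hle : leftAnn z ≤ leftAnn (z * r * z) := fun y hy => by
    rw [mem_leftAnn] at hy ⊢
    rw [mul_assoc, ← mul_assoc, hy, zero_mul]
  have hback := hmax _ ⟨isEssentialLeftIdeal_mono hz hle, hne⟩ hle
  have hzr : z * r ≠ 0 := fun h0 => hne (by rw [h0, zero_mul])
  -- Here `t * z * r * z = 0`, so maximality of `leftAnn z` puts `t` in it, against `t * (z * r) ≠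
  -- 0`.
  obtain ⟨t, ht, ht0⟩ := isEssentialLeftIdeal_iff.1 hz (z * r) hzr
  have h1 : t ∈ leftAnn (z * r * z) := by
    rw [mem_leftAnn] at ht ⊢
    rw [← mul_assoc, ht]
  have h2 := mem_leftAnn.1 (hback h1)
  exact ht0 (by rw [← mul_assoc, h2, zero_mul])

/-- In a ring of finite left uniform dimension a left regular element generates an essential left
ideal. -/
theorem FiniteLeftUniformDim.isEssential_span_singleton (h : FiniteLeftUniformDim R) {c : R}
    (hc : ∀ x, x * c = 0 → x = 0) : IsEssentialLeftIdeal (Ideal.span {c}) := by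
  obtain ⟨δ, hδ⟩ := h.exists_size
  intro V hV hbot
  have hpow : ∀ n x, x * c ^ n = 0 → x = 0 := by
    intro n
    induction n with
    | zero => intro x hx; simpa using hx
    | succ n ih => intro x hx; rw [pow_succ, ← mul_assoc] at hx; exact ih x (hc _ hx)
  -- If `V` met `Rc` trivially, `V c ^ n` would be a nonzero left ideal inside `R c ^ n` disjoint
  -- from `R c ^ (n + 1)`, and the sizes would descend forever.
  have hlt : ∀ n, δ (Ideal.span {c ^ (n + 1)}) < δ (Ideal.span {c ^ n}) := by
    intro n
    refine hδ _ _ (Submodule.map (LinearMap.toSpanSingleton R R (c ^ n)) V) ?_ ?_ ?_ ?_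
    · rw [Ideal.span_le, Set.singleton_subset_iff, pow_succ']
      exact Ideal.mul_mem_left _ _ (Ideal.subset_span rfl)
    · rintro _ ⟨v, hv, rfl⟩
      exact Ideal.mul_mem_left _ v (Ideal.subset_span rfl)
    · obtain ⟨v, hv, hv0⟩ := Submodule.exists_mem_ne_zero_of_ne_bot hV
      exact (Submodule.ne_bot_iff _).2 ⟨_, ⟨v, hv, rfl⟩, fun h0 => hv0 (hpow n v h0)⟩
    · rw [Submodule.disjoint_def]
      rintro _ ⟨v, hv, rfl⟩ h1
      obtain ⟨r, hr⟩ := Ideal.mem_span_singleton'.1 h1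
      have hv' : v * c ^ n = r * c ^ (n + 1) := hr.symm
      have h2 : v = r * c := sub_eq_zero.1 (hpow n _ (by
        rw [sub_mul, hv', pow_succ', mul_assoc, sub_self]))
      have h3 : v ∈ Ideal.span {c} ⊓ V := ⟨Ideal.mem_span_singleton'.2 ⟨r, h2.symm⟩, hv⟩
      rw [hbot, Submodule.mem_bot] at h3
      rw [h3]; simp
  exact not_strictAnti_of_wellFoundedLT _
    (strictAnti_nat_of_succ_lt (f := fun n => δ (Ideal.span {c ^ n})) hlt)

/-- A uniform left ideal of a semiprime left nonsingular ring has an element acting faithfully on it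
from the right. -/
theorem IsUniformLeftIdeal.exists_disjoint_leftAnn {U : Ideal R} (hU : IsUniformLeftIdeal U)
    (hs : ∀ a : R, (∀ r, a * r * a = 0) → a = 0)
    (hZ : ∀ x : R, IsEssentialLeftIdeal (leftAnn x) → x = 0) :
    ∃ u ∈ U, Disjoint U (leftAnn u) := by
  obtain ⟨w, hw, hw0⟩ := Submodule.exists_mem_ne_zero_of_ne_bot hU.ne_bot
  obtain ⟨r, hr⟩ : ∃ r, w * r * w ≠ 0 := by
    by_contra! hcon
    exact hw0 (hs w hcon)
  -- If `r * w` killed a nonzero part of `U`, uniformity would make `leftAnn (w * r * w)` essential,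
  -- hence `w * r * w = 0`.
  refine ⟨r * w, U.mul_mem_left r hw, ?_⟩
  by_contra hd
  rw [disjoint_iff, inf_comm] at hd
  refine hr (hZ _ (isEssentialLeftIdeal_iff.2 fun y hy => ?_))
  by_cases hyw : y * w = 0
  · exact ⟨1, by rw [one_mul, mem_leftAnn, mul_assoc, ← mul_assoc, hyw, zero_mul], by rwa [one_mul]⟩
  obtain ⟨t, ht, ht0⟩ := hU.exists_mul_mem hd (U.mul_mem_left y hw) hyw
  refine ⟨t, ?_, fun h0 => ht0 (by rw [← mul_assoc, h0, zero_mul])⟩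
  rw [mem_leftAnn] at ht ⊢
  rw [← ht]; simp only [mul_assoc]

/-- **Goldie's lemma**: an essential left ideal of a semiprime left Goldie ring contains a regular
element. -/
theorem IsLeftGoldie.exists_mem_nonZeroDivisors (h : IsLeftGoldie R)
    (hs : ∀ a : R, (∀ r, a * r * a = 0) → a = 0) {E : Ideal R} (hE : IsEssentialLeftIdeal E) :
    ∃ c ∈ E, c ∈ nonZeroDivisors R := by
  obtain ⟨δ, hδ⟩ := h.udim.exists_size
  have hZ : ∀ x : R, IsEssentialLeftIdeal (leftAnn x) → x = 0 :=
    fun x hx => h.acc.eq_zero_of_isEssential hs hx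
  -- The side condition says that `a * a` and `a` have the same left annihilator. If `leftAnn a` is
  -- nonzero, adding a suitable `u` from a uniform left ideal inside `leftAnn a ⊓ E` keeps this
  -- condition and strictly shrinks the annihilator.
  obtain ⟨a, ⟨haE, ha⟩, hmin⟩ := WellFounded.has_min
    (InvImage.wf (fun a : R => δ (leftAnn a)) Nat.lt_wfRel.wf)
    {a : R | a ∈ E ∧ ∀ x, x * a * a = 0 → x * a = 0} ⟨0, E.zero_mem, by simp⟩
  have hann : leftAnn a = ⊥ := by
    by_contra hne
    obtain ⟨U, hUle, hU⟩ := h.udim.exists_isUniformLeftIdeal_le (hE _ hne)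
    obtain ⟨u, hu, hdis⟩ := hU.exists_disjoint_leftAnn hs hZ
    have hdis' : ∀ x ∈ U, x * u = 0 → x = 0 := fun x hx hxu =>
      Submodule.disjoint_def.1 hdis x hx (mem_leftAnn.2 hxu)
    have hua : ∀ x ∈ U, x * a = 0 := fun x hx => mem_leftAnn.1 (hUle hx).2
    have hsplit : ∀ x, x * (a + u) = 0 → x * a = 0 ∧ x * u = 0 := by
      intro x hx
      have h1 : x * a = 0 := ha x (by
        have h2 : x * (a + u) * a = 0 := by rw [hx, zero_mul]
        rwa [mul_add, add_mul, hua _ (U.mul_mem_left x hu), add_zero] at h2)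
      exact ⟨h1, by rwa [mul_add, h1, zero_add] at hx⟩
    refine hmin (a + u) ⟨E.add_mem haE (hUle hu).1, fun x hx => ?_⟩
      (hδ _ _ U (fun x hx => ?_) (fun x hx => mem_leftAnn.2 (hua x hx)) hU.ne_bot ?_)
    · obtain ⟨h1, h2⟩ := hsplit _ hx
      have hxu : x * u ∈ U := U.mul_mem_left x hu
      rw [mul_add, add_mul, hua _ hxu, add_zero] at h1
      have h3 := ha x h1
      rw [mul_add, h3, zero_add] at h2 ⊢
      exact hdis' _ hxu h2
    · exact mem_leftAnn.2 (hsplit x (mem_leftAnn.1 hx)).1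
    · rw [Submodule.disjoint_def]
      exact fun x hx hxa => hdis' x hx (hsplit x (mem_leftAnn.1 hxa)).2
  have hreg : ∀ x, x * a = 0 → x = 0 := fun x hx => by
    simpa [hann] using (mem_leftAnn.2 hx : x ∈ leftAnn a)
  -- If `a * x = 0`, then `leftAnn x` contains the essential left ideal `Ra`, so nonsingularity
  -- gives `x = 0`.
  refine ⟨a, haE, fun x hx => hZ x ?_, hreg⟩
  refine isEssentialLeftIdeal_mono (h.udim.isEssential_span_singleton hreg) ?_
  rw [Ideal.span_le, Set.singleton_subset_iff]
  exact mem_leftAnn.2 hx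

end GoldieTheory

/-! ### Prime and semiprime ideals through elements, and minimal primes. -/

section PrimeTheory

variable {R : Type*} [Ring R]

/-- The two-sided ideal of the `y` with `a R y ⊆ I`. -/
def transporter (I : TwoSidedIdeal R) (a : R) : TwoSidedIdeal R :=
  .mk' {y | ∀ r, a * r * y ∈ I} (fun r => by simp)
    (fun {x y} hx hy r => by rw [mul_add]; exact I.add_mem (hx r) (hy r))
    (fun {x} hx r => by rw [mul_neg]; exact I.neg_mem (hx r))
    (fun {x y} hy r => by rw [← mul_assoc, mul_assoc a]; exact hy (r * x))
    (fun {x y} hx r => by rw [← mul_assoc]; exact I.mul_mem_right _ _ (hx r))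

theorem mem_transporter {I : TwoSidedIdeal R} {a y : R} :
    y ∈ transporter I a ↔ ∀ r, a * r * y ∈ I :=
  TwoSidedIdeal.mem_mk' _ _ _ _ _ _ _

/-- The two-sided ideal of the `x` with `x B ⊆ I`. -/
def residual (I B : TwoSidedIdeal R) : TwoSidedIdeal R :=
  .mk' {x | ∀ b ∈ B, x * b ∈ I} (fun b _ => by simp)
    (fun {x y} hx hy b hb => by rw [add_mul]; exact I.add_mem (hx b hb) (hy b hb))
    (fun {x} hx b hb => by rw [neg_mul]; exact I.neg_mem (hx b hb))
    (fun {x y} hy b hb => by rw [mul_assoc]; exact I.mul_mem_left _ _ (hy b hb))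
    (fun {x y} hx b hb => by rw [mul_assoc]; exact hx _ (B.mul_mem_left _ _ hb))

theorem mem_residual {I B : TwoSidedIdeal R} {x : R} :
    x ∈ residual I B ↔ ∀ b ∈ B, x * b ∈ I :=
  TwoSidedIdeal.mem_mk' _ _ _ _ _ _ _

theorem mem_residual_transporter {I : TwoSidedIdeal R} {a : R} :
    a ∈ residual I (transporter I a) :=
  mem_residual.2 fun b hb => by simpa using mem_transporter.1 hb 1

theorem IsPrimeIdeal.one_notMem {P : TwoSidedIdeal R} (hP : IsPrimeIdeal P) : (1 : R) ∉ P :=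
  fun h => hP.ne_top ((TwoSidedIdeal.one_mem_iff P).1 h)

/-- `residual` and `transporter` contain `a` and `b` and multiply into `P`, so they serve in place
of the ideals generated by `a` and `b`. -/
theorem IsPrimeIdeal.mem_or_mem {P : TwoSidedIdeal R} (hP : IsPrimeIdeal P) {a b : R}
    (h : ∀ r, a * r * b ∈ P) : a ∈ P ∨ b ∈ P :=
  (hP.le_or_le (residual P (transporter P a)) (transporter P a)
    fun _ hx y hy => mem_residual.1 hx y hy).imp
    (fun hle => hle mem_residual_transporter) (fun hle => hle (mem_transporter.2 h))

theorem IsPrimeIdeal.exists_mul_mul_notMem {P : TwoSidedIdeal R} (hP : IsPrimeIdeal P) {a b : R}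
    (ha : a ∉ P) (hb : b ∉ P) : ∃ r, a * r * b ∉ P := by
  by_contra! h
  exact (hP.mem_or_mem h).elim ha hb

theorem isPrimeIdeal_of_mem_or_mem {P : TwoSidedIdeal R} (h1 : (1 : R) ∉ P)
    (h : ∀ a b : R, (∀ r, a * r * b ∈ P) → a ∈ P ∨ b ∈ P) : IsPrimeIdeal P := by
  refine ⟨fun ht => h1 (ht ▸ TwoSidedIdeal.mem_top R), fun A B hAB => ?_⟩
  by_contra! hcon
  obtain ⟨hA, hB⟩ := hcon
  obtain ⟨a, ha, haP⟩ := SetLike.not_le_iff_exists.1 hA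
  obtain ⟨b, hb, hbP⟩ := SetLike.not_le_iff_exists.1 hB
  exact (h a b fun r => hAB _ (A.mul_mem_right _ _ ha) b hb).elim haP hbP

theorem IsSemiprimeIdeal.mem_of_mul_mul_mem {I : TwoSidedIdeal R} (hI : IsSemiprimeIdeal I) {a : R}
    (h : ∀ r, a * r * a ∈ I) : a ∈ I :=
  hI (residual I (transporter I a) ⊓ transporter I a)
    (fun _ hx y hy => mem_residual.1 hx.1 y hy.2)
    ⟨mem_residual_transporter, mem_transporter.2 h⟩

/-- An ideal that contains a given ideal and is maximal with respect to avoiding an `m`-sequence is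
prime; hence every element outside a semiprime ideal is avoided by some prime over it. -/
theorem IsSemiprimeIdeal.exists_isPrimeIdeal {I : TwoSidedIdeal R} (hI : IsSemiprimeIdeal I) {x : R}
    (hx : x ∉ I) : ∃ P, IsPrimeIdeal P ∧ I ≤ P ∧ x ∉ P := by
  have hnext : ∀ y : {y : R // y ∉ I}, ∃ r, y.1 * r * y.1 ∉ I := fun y => by
    by_contra! h
    exact y.2 (hI.mem_of_mul_mul_mem h)
  choose ρ hρ using hnext
  let g : ℕ → {y : R // y ∉ I} := fun n => Nat.rec ⟨x, hx⟩ (fun _ y => ⟨y.1 * ρ y * y.1, hρ y⟩) n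
  have hg : ∀ n, (g (n + 1)).1 = (g n).1 * ρ (g n) * (g n).1 := fun n => rfl
  have hmono : ∀ (A : TwoSidedIdeal R) (n m : ℕ), n ≤ m → (g n).1 ∈ A → (g m).1 ∈ A := by
    intro A n m hnm hn
    induction hnm with
    | refl => exact hn
    | step _ ih => rw [Nat.succ_eq_add_one, hg]; exact A.mul_mem_left _ _ ih
  obtain ⟨P, hIP, hP⟩ := zorn_le_nonempty₀ {J : TwoSidedIdeal R | I ≤ J ∧ ∀ n, (g n).1 ∉ J}
    (fun c hc hchain J hJ => by
      have hne : c.Nonempty := ⟨J, hJ⟩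
      have hdir : ∀ A ∈ c, ∀ B ∈ c, ∃ C ∈ c, A ≤ C ∧ B ≤ C := fun A hA B hB =>
        (hchain.total hA hB).elim (fun h => ⟨B, hB, h, le_rfl⟩) fun h => ⟨A, hA, le_rfl, h⟩
      let M : TwoSidedIdeal R := .mk' {y | ∃ A ∈ c, y ∈ A} ⟨J, hJ, J.zero_mem⟩
        (by
          rintro y z ⟨A, hA, hy⟩ ⟨B, hB, hz⟩
          obtain ⟨C, hC, hAC, hBC⟩ := hdir A hA B hB
          exact ⟨C, hC, C.add_mem (hAC hy) (hBC hz)⟩)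
        (by rintro y ⟨A, hA, hy⟩; exact ⟨A, hA, A.neg_mem hy⟩)
        (by rintro y z ⟨A, hA, hz⟩; exact ⟨A, hA, A.mul_mem_left _ _ hz⟩)
        (by rintro y z ⟨A, hA, hy⟩; exact ⟨A, hA, A.mul_mem_right _ _ hy⟩)
      have hM : ∀ y, y ∈ M ↔ ∃ A ∈ c, y ∈ A := fun y => TwoSidedIdeal.mem_mk' _ _ _ _ _ _ _
      refine ⟨M, ⟨fun y hy => (hM y).2 ⟨J, hJ, (hc hJ).1 hy⟩, fun n hn => ?_⟩,
        fun A hA y hy => (hM y).2 ⟨A, hA, hy⟩⟩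
      obtain ⟨A, hA, h⟩ := (hM _).1 hn
      exact (hc hA).2 n h) I ⟨le_rfl, fun n => (g n).2⟩
  -- By maximality of `P`, each ideal not inside `P` meets the sequence after adding `P`. For two
  -- such ideals with product in `P`, a common later term lies in both sums, and the term following
  -- it would lie in `P`.
  have hmeet : ∀ A, ¬ A ≤ P → ∃ n, (g n).1 ∈ P ⊔ A := by
    intro A hA
    by_contra! hcon
    exact hA (le_sup_right.trans (hP.2 ⟨hIP.trans le_sup_left, hcon⟩ le_sup_left))
  refine ⟨P, ⟨fun ht => hP.1.2 0 (ht ▸ TwoSidedIdeal.mem_top R), fun A B hAB => ?_⟩, hIP, hP.1.2 0⟩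
  by_contra! hcon
  obtain ⟨n, hn⟩ := hmeet A hcon.1
  obtain ⟨m, hm⟩ := hmeet B hcon.2
  have hn' := hmono _ n (max n m) (le_max_left _ _) hn
  have hm' := hmono _ m (max n m) (le_max_right _ _) hm
  refine hP.1.2 (max n m + 1) ?_
  rw [hg]
  obtain ⟨p, hp, a, ha, e₁⟩ := TwoSidedIdeal.mem_sup.1 hn'
  obtain ⟨q, hq, b, hb, e₂⟩ := TwoSidedIdeal.mem_sup.1 hm'
  generalize ρ (g (max n m)) = r
  nth_rewrite 1 [← e₁]
  rw [← e₂]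
  have e : (p + a) * r * (q + b) = p * (r * (q + b)) + a * r * q + a * r * b := by noncomm_ring
  rw [e]
  exact P.add_mem (P.add_mem (P.mul_mem_right _ _ hp) (P.mul_mem_left _ _ hq))
    (hAB _ (A.mul_mem_right _ _ ha) _ hb)

/-- The intersection of a nonempty chain of primes is prime, so Zorn's lemma applies in the reversed
order. -/
theorem exists_minPrimes_le {I P : TwoSidedIdeal R} (hP : IsPrimeIdeal P) (hI : I ≤ P) :
    ∃ Q ∈ minPrimes I, Q ≤ P := by
  obtain ⟨Q, hQP, hQ⟩ := zorn_le_nonempty₀ (α := (TwoSidedIdeal R)ᵒᵈ)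
    {Q | IsPrimeIdeal (OrderDual.ofDual Q) ∧ I ≤ OrderDual.ofDual Q}
    (fun c hc hchain J hJ => by
      let M : TwoSidedIdeal R := sInf {A | OrderDual.toDual A ∈ c}
      have hM : ∀ y, y ∈ M ↔ ∀ A, OrderDual.toDual A ∈ c → y ∈ A :=
        fun y => TwoSidedIdeal.mem_sInf R
      refine ⟨OrderDual.toDual M, ⟨isPrimeIdeal_of_mem_or_mem
        (fun h => (hc hJ).1.one_notMem ((hM 1).1 h _ hJ)) fun a b hab => ?_,
        fun y hy => (hM y).2 fun A hA => (hc hA).2 hy⟩,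
        fun A hA y hy => (hM y).1 hy _ hA⟩
      by_contra! hcon
      obtain ⟨ha, hb⟩ := hcon
      replace ha := mt (hM a).2 ha
      replace hb := mt (hM b).2 hb
      push Not at ha hb
      obtain ⟨A, hA, haA⟩ := ha
      obtain ⟨B, hB, hbB⟩ := hb
      rcases hchain.total hA hB with h | h
      · have h' : B ≤ A := h
        exact ((hc hB).1.mem_or_mem fun r => (hM _).1 (hab r) B hB).elim
          (fun h1 => haA (h' h1)) hbB
      · have h' : A ≤ B := h
        exact ((hc hA).1.mem_or_mem fun r => (hM _).1 (hab r) A hA).elim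
          haA (fun h1 => hbB (h' h1)))
    (OrderDual.toDual P) ⟨hP, hI⟩
  exact ⟨OrderDual.ofDual Q, ⟨hQ.1, fun A hA hle => hQ.2 hA hle⟩, hQP⟩

theorem IsSemiprimeIdeal.mem_iff_forall_minPrimes {I : TwoSidedIdeal R} (hI : IsSemiprimeIdeal I)
    {x : R} : x ∈ I ↔ ∀ P ∈ minPrimes I, x ∈ P := by
  refine ⟨fun hx P hP => hP.1.2 hx, fun h => ?_⟩
  by_contra hx
  obtain ⟨P, hP, hIP, hxP⟩ := hI.exists_isPrimeIdeal hx
  obtain ⟨Q, hQ, hQP⟩ := exists_minPrimes_le hP hIP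
  exact hxP (hQP (h Q hQ))

theorem IsPrimeIdeal.exists_notMem_of_forall_not_le {ι : Type*} {P : TwoSidedIdeal R}
    (hP : IsPrimeIdeal P) {Q : ι → TwoSidedIdeal R} (s : Finset ι) (h : ∀ j ∈ s, ¬ Q j ≤ P) :
    ∃ x ∉ P, ∀ j ∈ s, x ∈ Q j := by
  classical
  induction s using Finset.induction_on with
  | empty => exact ⟨1, hP.one_notMem, by simp⟩
  | insert i s _ ih =>
    obtain ⟨x, hx, hxs⟩ := ih fun j hj => h j (Finset.mem_insert_of_mem hj)
    obtain ⟨y, hy, hyP⟩ := SetLike.not_le_iff_exists.1 (h i (Finset.mem_insert_self i s))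
    obtain ⟨r, hr⟩ := hP.exists_mul_mul_notMem hx hyP
    refine ⟨x * r * y, hr, fun j hj => ?_⟩
    rcases Finset.mem_insert.1 hj with rfl | hj
    · exact TwoSidedIdeal.mul_mem_left _ _ _ hy
    · exact TwoSidedIdeal.mul_mem_right _ _ _ (TwoSidedIdeal.mul_mem_right _ _ _ (hxs j hj))

theorem mk'_eq_zero {I : TwoSidedIdeal R} {x : R} : I.ringCon.mk' x = 0 ↔ x ∈ I := by
  rw [← TwoSidedIdeal.mem_ker, TwoSidedIdeal.ker_ringCon_mk']

theorem mk'_mem_nonZeroDivisors {I : TwoSidedIdeal R} {c : R} :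
    I.ringCon.mk' c ∈ nonZeroDivisors I.ringCon.Quotient ↔
      (∀ x, c * x ∈ I → x ∈ I) ∧ ∀ x, x * c ∈ I → x ∈ I := by
  rw [mem_nonZeroDivisors_iff]
  simp only [I.ringCon.mk'_surjective.forall, ← map_mul, mk'_eq_zero]

end PrimeTheory

/-! ### From the minimal primes to the semiprime ideal. -/

section Gluing

variable {R : Type*} [Ring R]

/-- Goldie's lemma in `R/P`, lifted to `R`: the hypothesis on `J` says that its image is essential.
-/
theorem exists_mem_regular_of_isLeftGoldie {P : TwoSidedIdeal R} (hP : IsPrimeIdeal P)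
    (hG : IsLeftGoldie P.ringCon.Quotient) {J : Ideal R}
    (hJ : ∀ r ∉ P, ∃ t, t * r ∈ J ∧ t * r ∉ P) :
    ∃ c ∈ J, (∀ x, c * x ∈ P → x ∈ P) ∧ ∀ x, x * c ∈ P → x ∈ P := by
  have hsurj := P.ringCon.mk'_surjective
  have hE : IsEssentialLeftIdeal (J.map P.ringCon.mk') := by
    rw [isEssentialLeftIdeal_iff, hsurj.forall]
    intro r hr
    obtain ⟨t, ht, ht'⟩ := hJ r (mt mk'_eq_zero.2 hr)
    exact ⟨P.ringCon.mk' t, by rw [← map_mul]; exact Ideal.mem_map_of_mem _ ht,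
      by rw [← map_mul]; exact mt mk'_eq_zero.1 ht'⟩
  obtain ⟨c, hc, hreg⟩ := hG.exists_mem_nonZeroDivisors (by
    rw [hsurj.forall]
    intro a ha
    rw [mk'_eq_zero]
    exact or_self_iff.1 (hP.mem_or_mem fun r => by
      have := ha (P.ringCon.mk' r)
      rwa [← map_mul, ← map_mul, mk'_eq_zero] at this)) hE
  obtain ⟨c, hcJ, rfl⟩ := (Ideal.mem_map_iff_of_surjective _ hsurj).1 hc
  exact ⟨c, hcJ, mk'_mem_nonZeroDivisors.1 hreg⟩

theorem exists_mul_sub_mem_of_isLeftGoldie {P : TwoSidedIdeal R}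
    (hG : IsLeftGoldie P.ringCon.Quotient) {c : R} (hc : ∀ x, x * c ∈ P → x ∈ P) {r : R}
    (hr : r ∉ P) : ∃ t y, t * r ∉ P ∧ t * r - y * c ∈ P := by
  have hsurj := P.ringCon.mk'_surjective
  have hess := hG.udim.isEssential_span_singleton (c := P.ringCon.mk' c) (by
    rw [hsurj.forall]
    intro x hx
    rw [← map_mul, mk'_eq_zero] at hx
    exact mk'_eq_zero.2 (hc x hx))
  obtain ⟨t, ht, ht0⟩ := isEssentialLeftIdeal_iff.1 hess _ (mt mk'_eq_zero.1 hr)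
  obtain ⟨y, hy⟩ := Ideal.mem_span_singleton'.1 ht
  obtain ⟨t, rfl⟩ := hsurj t
  obtain ⟨y, rfl⟩ := hsurj y
  rw [← map_mul] at ht0
  refine ⟨t, y, mt mk'_eq_zero.2 ht0, mk'_eq_zero.1 ?_⟩
  rw [map_sub, map_mul, map_mul, hy, sub_self]

/-- A semiprime ideal with finitely many minimal primes, all with left Goldie residue rings. -/
structure IsGoldieSemiprime (I : TwoSidedIdeal R) : Prop where
  semiprime : IsSemiprimeIdeal I
  finite : (minPrimes I).Finite
  goldie : ∀ P ∈ minPrimes I, IsLeftGoldie P.ringCon.Quotient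

namespace IsGoldieSemiprime

variable {I : TwoSidedIdeal R}

theorem exists_separator (hI : IsGoldieSemiprime I) {P : TwoSidedIdeal R} (hP : P ∈ minPrimes I) :
    ∃ e ∉ P, ∀ Q ∈ minPrimes I, Q ≠ P → e ∈ Q := by
  classical
  obtain ⟨e, he, h⟩ := hP.1.1.exists_notMem_of_forall_not_le (Q := id)
    (hI.finite.toFinset.erase P) (fun Q hQ hle => by
      rw [Finset.mem_erase, Set.Finite.mem_toFinset] at hQ
      exact hQ.1 (hle.antisymm (hP.2 hQ.2.1 hle)))
  exact ⟨e, he, fun Q hQ hne => h Q (by simp [hne, hQ])⟩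

theorem mem_of_forall_ne (hI : IsGoldieSemiprime I) {P : TwoSidedIdeal R} {x : R} (hx : x ∈ P)
    (h : ∀ Q ∈ minPrimes I, Q ≠ P → x ∈ Q) : x ∈ I :=
  hI.semiprime.mem_iff_forall_minPrimes.2 fun Q hQ => by
    by_cases hQP : Q = P
    · rwa [hQP]
    · exact h Q hQ hQP

/-- For each minimal `P`, the part of `J` lying in all other minimal primes is still essential
modulo `P`, because a separator can be inserted before `r`. It therefore contains some `c P` regular
modulo `P`. The sum of the `c P` is congruent to `c P` modulo each `P`, so it is regular modulo `I`.
-/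
theorem exists_mem_regular (hI : IsGoldieSemiprime I) {J : Ideal R}
    (hJ : ∀ r ∉ I, ∃ t, t * r ∈ J ∧ t * r ∉ I) :
    ∃ c ∈ J, (∀ x, c * x ∈ I → x ∈ I) ∧ ∀ x, x * c ∈ I → x ∈ I := by
  classical
  have key : ∀ P ∈ minPrimes I, ∃ c ∈ J, (∀ Q ∈ minPrimes I, Q ≠ P → c ∈ Q) ∧
      (∀ x, c * x ∈ P → x ∈ P) ∧ ∀ x, x * c ∈ P → x ∈ P := by
    intro P hP
    obtain ⟨e, heP, he⟩ := hI.exists_separator hP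
    let A : Ideal R :=
      { carrier := {x | ∀ Q ∈ minPrimes I, Q ≠ P → x ∈ Q}
        add_mem' := fun hx hy Q hQ hne => Q.add_mem (hx Q hQ hne) (hy Q hQ hne)
        zero_mem' := fun Q _ _ => Q.zero_mem
        smul_mem' := fun r x hx Q hQ hne => Q.mul_mem_left r x (hx Q hQ hne) }
    obtain ⟨c, ⟨hcJ, hcA⟩, hc⟩ := exists_mem_regular_of_isLeftGoldie hP.1.1 (hI.goldie P hP)
      (J := J ⊓ A) (fun r hr => by
        obtain ⟨s, hs⟩ := hP.1.1.exists_mul_mul_notMem heP hr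
        obtain ⟨t, htJ, htI⟩ := hJ (e * s * r) fun h => hs (hP.1.2 h)
        have htA : ∀ Q ∈ minPrimes I, Q ≠ P → t * (e * s * r) ∈ Q := fun Q hQ hne =>
          Q.mul_mem_left _ _ (Q.mul_mem_right _ _ (Q.mul_mem_right _ _ (he Q hQ hne)))
        refine ⟨t * (e * s), ?_, ?_⟩ <;> rw [mul_assoc]
        · exact ⟨htJ, htA⟩
        · exact fun h => htI (hI.mem_of_forall_ne h htA))
    exact ⟨c, hcJ, hcA, hc⟩
  choose! c hcJ hcQ hcl hcr using key
  have hcongr : ∀ P ∈ minPrimes I, ∑ Q ∈ hI.finite.toFinset, c Q - c P ∈ P := by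
    intro P hP
    rw [← Finset.add_sum_erase _ _ (hI.finite.mem_toFinset.2 hP), add_sub_cancel_left]
    refine sum_mem fun Q hQ => ?_
    rw [Finset.mem_erase, Set.Finite.mem_toFinset] at hQ
    exact hcQ Q hQ.2 P hP hQ.1.symm
  refine ⟨∑ Q ∈ hI.finite.toFinset, c Q,
    sum_mem fun Q hQ => hcJ Q (hI.finite.mem_toFinset.1 hQ), fun x hx => ?_, fun x hx => ?_⟩
  · refine hI.semiprime.mem_iff_forall_minPrimes.2 fun P hP => hcl P hP x ?_
    have h1 := P.sub_mem (hP.1.2 hx) (P.mul_mem_right _ x (hcongr P hP))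
    rwa [sub_mul, sub_sub_cancel] at h1
  · refine hI.semiprime.mem_iff_forall_minPrimes.2 fun P hP => hcr P hP x ?_
    have h1 := P.sub_mem (hP.1.2 hx) (P.mul_mem_left x _ (hcongr P hP))
    rwa [mul_sub, sub_sub_cancel] at h1

/-- Left multiplication by a separator of `P` turns a congruence modulo `P` into one modulo `I`. -/
theorem exists_mul_sub_mem (hI : IsGoldieSemiprime I) {c : R} (hc : ∀ x, x * c ∈ I → x ∈ I) {r : R}
    (hr : r ∉ I) : ∃ t y, t * r ∉ I ∧ t * r - y * c ∈ I := by
  rw [hI.semiprime.mem_iff_forall_minPrimes] at hr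
  push Not at hr
  obtain ⟨P, hP, hrP⟩ := hr
  obtain ⟨e, heP, he⟩ := hI.exists_separator hP
  have hsep : ∀ s x, ∀ Q ∈ minPrimes I, Q ≠ P → e * s * x ∈ Q := fun s x Q hQ hne =>
    Q.mul_mem_right _ _ (Q.mul_mem_right _ _ (he Q hQ hne))
  obtain ⟨t, y, ht, hty⟩ := exists_mul_sub_mem_of_isLeftGoldie (hI.goldie P hP) (c := c)
    (fun x hx => by
      by_contra hxP
      obtain ⟨s, hs⟩ := hP.1.1.exists_mul_mul_notMem heP hxP
      refine hs (hP.1.2 (hc _ (hI.mem_of_forall_ne (P := P) ?_ ?_)))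
      · rw [mul_assoc]; exact P.mul_mem_left _ _ hx
      · rw [mul_assoc]; exact hsep s _) hrP
  obtain ⟨s, hs⟩ := hP.1.1.exists_mul_mul_notMem heP ht
  refine ⟨e * s * t, e * s * y, fun h => hs (hP.1.2 (by rwa [mul_assoc] at h)), ?_⟩
  rw [mul_assoc _ t, mul_assoc _ y, ← mul_sub]
  exact hI.mem_of_forall_ne (P.mul_mem_left _ _ hty) (hsep s _)

/-- The left Ore condition for the elements that are regular modulo a semiprime ideal. -/
theorem exists_regular_mul_sub_mem (hI : IsGoldieSemiprime I) {c : R}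
    (hc : ∀ x, x * c ∈ I → x ∈ I) (r : R) :
    ∃ d y, ((∀ x, d * x ∈ I → x ∈ I) ∧ ∀ x, x * d ∈ I → x ∈ I) ∧ d * r - y * c ∈ I := by
  -- `J` consists of the `x` with `x * r ∈ Rc + I`; it is essential modulo `I`, so it contains a
  -- regular element modulo `I`.
  let J : Ideal R :=
    { carrier := {x | ∃ y, x * r - y * c ∈ I}
      add_mem' := by
        rintro x x' ⟨y, hy⟩ ⟨y', hy'⟩
        refine ⟨y + y', ?_⟩
        rw [add_mul, add_mul, add_sub_add_comm]
        exact I.add_mem hy hy'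
      zero_mem' := ⟨0, by simp⟩
      smul_mem' := by
        rintro s x ⟨y, hy⟩
        refine ⟨s * y, ?_⟩
        rw [smul_eq_mul, mul_assoc, mul_assoc, ← mul_sub]
        exact I.mul_mem_left _ _ hy }
  obtain ⟨d, ⟨y, hy⟩, hd⟩ := hI.exists_mem_regular (J := J) (fun x hx => by
    by_cases hxr : x * r ∈ I
    · exact ⟨1, ⟨0, by simpa using hxr⟩, by rwa [one_mul]⟩
    · obtain ⟨t, y, ht, hty⟩ := hI.exists_mul_sub_mem hc hxr
      rw [← mul_assoc] at ht hty
      exact ⟨t, ⟨y, hty⟩, fun h => ht (I.mul_mem_right _ _ h)⟩)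
  exact ⟨d, y, hd, hy⟩

end IsGoldieSemiprime

end Gluing

/-! ### Transfer between a ring and a ring of left fractions. -/

section LeftOrders

variable {R Q : Type*} [Ring R] [Ring Q]

/-- `φ : R → Q` inverts `S`, and every element of `Q` is a left fraction with denominator in `S`. -/
structure IsLeftOrder (S : Submonoid R) (φ : R →+* Q) : Prop where
  isUnit : ∀ s ∈ S, IsUnit (φ s)
  exists_mul_eq : ∀ q : Q, ∃ s ∈ S, ∃ r, φ s * q = φ r

namespace IsLeftOrder

variable {S : Submonoid R} {φ : R →+* Q}

theorem comp_surjective (h : IsLeftOrder S φ) {Q' : Type*} [Ring Q'] {ψ : Q →+* Q'}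
    (hψ : Function.Surjective ψ) : IsLeftOrder S (ψ.comp φ) where
  isUnit s hs := (h.isUnit s hs).map ψ
  exists_mul_eq := by
    rw [hψ.forall]
    intro q
    obtain ⟨s, hs, r, e⟩ := h.exists_mul_eq q
    exact ⟨s, hs, r, by rw [RingHom.comp_apply, ← map_mul, e, RingHom.comp_apply]⟩

theorem of_comp {T : Type*} [Ring T] {π : R →+* T} {ψ : T →+* Q}
    (h : IsLeftOrder S (ψ.comp π)) : IsLeftOrder (S.map π) ψ where
  isUnit := by
    rintro _ ⟨s, hs, rfl⟩
    exact h.isUnit s hs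
  exists_mul_eq q := by
    obtain ⟨s, hs, r, e⟩ := h.exists_mul_eq q
    exact ⟨π s, ⟨s, hs, rfl⟩, π r, e⟩

theorem mul_left_eq_zero (h : IsLeftOrder S φ) {s : R} (hs : s ∈ S) {q : Q} :
    φ s * q = 0 ↔ q = 0 :=
  (h.isUnit s hs).mul_right_eq_zero

/-- Only stability under the inverses of the `φ s` is in question. For `u = φ s` the left ideals of
`x` with `x * u ^ n ∈ L` ascend, and their stabilization, tested on `y * u⁻¹ ^ (n + 1)`, gives `y *
u⁻¹ ∈ L`. -/
theorem isTwoSided_of_mul_mem (h : IsLeftOrder S φ) [IsNoetherianRing Q] {L : Ideal Q}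
    (hL : ∀ x ∈ L, ∀ r, x * φ r ∈ L) : L.IsTwoSided := by
  have hinv : ∀ s ∈ S, ∀ u : Qˣ, (u : Q) = φ s → ∀ y ∈ L, y * ↑u⁻¹ ∈ L := by
    intro s hs u hu y hy
    let f : ℕ →o Ideal Q :=
      ⟨fun n => Submodule.comap (LinearMap.toSpanSingleton Q Q (u ^ n : Q)) L,
        monotone_nat_of_le_succ fun n x hx => by
          simp only [Submodule.mem_comap, LinearMap.toSpanSingleton_apply, smul_eq_mul] at hx ⊢
          rw [pow_succ, ← mul_assoc]
          nth_rewrite 2 [hu]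
          exact hL _ hx s⟩
    obtain ⟨n, hn⟩ := monotone_stabilizes_iff_noetherian.2 ‹IsNoetherianRing Q› f
    have h1 : y * ↑(u⁻¹ ^ (n + 1)) ∈ f (n + 1) := by
      change y * ↑(u⁻¹ ^ (n + 1)) * (u : Q) ^ (n + 1) ∈ L
      rw [mul_assoc, ← Units.val_pow_eq_pow_val, ← Units.val_mul]
      simpa using hy
    rw [← hn (n + 1) n.le_succ] at h1
    have h2 : y * ↑(u⁻¹ ^ (n + 1)) * (u : Q) ^ n ∈ L := h1
    rw [mul_assoc, ← Units.val_pow_eq_pow_val, ← Units.val_mul, pow_succ', mul_assoc] at h2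
    simpa using h2
  refine ⟨fun {x} q hx => ?_⟩
  obtain ⟨s, hs, r, e⟩ := h.exists_mul_eq q
  obtain ⟨u, hu⟩ := h.isUnit s hs
  have hq : q = ↑u⁻¹ * φ r := by rw [← e, ← hu, Units.inv_mul_cancel_left]
  rw [hq, ← mul_assoc]
  exact hL _ (hinv s hs u hu x hx) r

/-- If `φ '' A` is not zero, the left ideal it generates is two-sided, hence all of `Q`; as it kills
each `φ b`, so does `1`. -/
theorem isPrimeIdeal_ker (h : IsLeftOrder S φ) [IsSimpleRing Q] [IsNoetherianRing Q] :
    IsPrimeIdeal (TwoSidedIdeal.ker φ) := by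
  refine ⟨fun ht => one_ne_zero (α := Q) ?_, fun A B hAB => ?_⟩
  · have : (1 : R) ∈ TwoSidedIdeal.ker φ := ht ▸ TwoSidedIdeal.mem_top R
    rwa [TwoSidedIdeal.mem_ker, map_one] at this
  by_contra! hcon
  obtain ⟨a, ha, haφ⟩ := SetLike.not_le_iff_exists.1 hcon.1
  obtain ⟨b, hb, hbφ⟩ := SetLike.not_le_iff_exists.1 hcon.2
  rw [TwoSidedIdeal.mem_ker] at haφ hbφ
  let L : Ideal Q := Ideal.span (φ '' A)
  have hL : L.IsTwoSided := h.isTwoSided_of_mul_mem fun x hx r => by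
    induction hx using Submodule.span_induction with
    | mem x hx =>
      obtain ⟨y, hy, rfl⟩ := hx
      rw [← map_mul]
      exact Ideal.subset_span ⟨_, A.mul_mem_right _ _ hy, rfl⟩
    | zero => rw [zero_mul]; exact L.zero_mem
    | add x y _ _ hx hy => rw [add_mul]; exact L.add_mem hx hy
    | smul q x _ hx => rw [smul_eq_mul, mul_assoc]; exact L.mul_mem_left q hx
  have haL : φ a ∈ L := Ideal.subset_span ⟨a, ha, rfl⟩
  have htop : L = ⊤ := ((isSimpleRing_iff_isTwoSided_imp.1 ‹_›).2 L hL).resolve_left fun hbot => by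
    rw [hbot] at haL
    exact haφ haL
  have hle : L ≤ leftAnn (φ b) := by
    rw [Ideal.span_le]
    rintro _ ⟨x, hx, rfl⟩
    exact mem_leftAnn.2 (by rw [← map_mul]; exact (TwoSidedIdeal.mem_ker φ).1 (hAB x hx b hb))
  have h1 : (1 : Q) ∈ leftAnn (φ b) := hle (htop ▸ Submodule.mem_top)
  exact hbφ (by simpa using mem_leftAnn.1 h1)

/-- A left annihilator is recovered by contraction from the left annihilator in `Q` of the image of
its right annihilator, so the chain condition descends from `Q`. -/
theorem _root_.LeftQuot.ACCLeftAnnihilators.of_injective [IsNoetherianRing Q]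
    (hφ : Function.Injective φ) : ACCLeftAnnihilators R := by
  intro f hf
  let g : ℕ →o Ideal Q :=
    ⟨fun n =>
      { carrier := {q | ∀ x : R, (∀ r ∈ f n, r * x = 0) → q * φ x = 0}
        add_mem' := fun hp hq x hx => by rw [add_mul, hp x hx, hq x hx, add_zero]
        zero_mem' := fun x _ => zero_mul _
        smul_mem' := fun p q hq x hx => by rw [smul_eq_mul, mul_assoc, hq x hx, mul_zero] },
      fun n m hnm q hq x hx => hq x fun r hr => hx r (f.2 hnm hr)⟩
  have hg : ∀ n r, r ∈ f n ↔ φ r ∈ g n := by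
    intro n r
    obtain ⟨X, hX⟩ := hf n
    refine ⟨fun hr x hx => by rw [← map_mul, hx r hr, map_zero], fun hr => (hX r).2 fun x hx => ?_⟩
    have := hr x fun r' hr' => (hX r').1 hr' x hx
    rwa [← map_mul, map_eq_zero_iff φ hφ] at this
  obtain ⟨n, hn⟩ := monotone_stabilizes_iff_noetherian.2 ‹IsNoetherianRing Q› g
  refine ⟨n, fun m hm => ?_⟩
  ext r
  rw [hg, hg, hn m hm]

theorem isUniform_comap (h : IsLeftOrder S φ) (hφ : Function.Injective φ) {T : Ideal Q}
    (hT : IsAtom T) : IsUniformLeftIdeal (T.comap φ) := by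
  refine ⟨?_, fun K L hK hL hK0 hL0 => ?_⟩
  · obtain ⟨t, ht, ht0⟩ := Submodule.exists_mem_ne_zero_of_ne_bot hT.1
    obtain ⟨s, hs, r, e⟩ := h.exists_mul_eq t
    refine (Submodule.ne_bot_iff _).2 ⟨r, ?_, ?_⟩
    · rw [Ideal.mem_comap, ← e]
      exact T.mul_mem_left _ ht
    · rintro rfl
      rw [map_zero, h.mul_left_eq_zero hs] at e
      exact ht0 e
  · obtain ⟨k, hk, hk0⟩ := Submodule.exists_mem_ne_zero_of_ne_bot hK0
    obtain ⟨l, hl, hl0⟩ := Submodule.exists_mem_ne_zero_of_ne_bot hL0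
    have hspan : Ideal.span {φ l} = T := (hT.le_iff.1 (by
      rw [Ideal.span_le, Set.singleton_subset_iff]; exact hL hl)).resolve_left (by
      rwa [Ideal.span_singleton_eq_bot, map_eq_zero_iff φ hφ])
    have hkT : φ k ∈ T := hK hk
    rw [← hspan] at hkT
    obtain ⟨q, hq⟩ := Ideal.mem_span_singleton'.1 hkT
    obtain ⟨s, hs, r, e⟩ := h.exists_mul_eq q
    have hsk : s * k = r * l := hφ (by rw [map_mul, map_mul, ← hq, ← mul_assoc, e])
    refine (Submodule.ne_bot_iff _).2
      ⟨s * k, ⟨K.mul_mem_left s hk, hsk ▸ L.mul_mem_left r hl⟩, fun h0 => hk0 (hφ ?_)⟩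
    rw [map_zero, ← h.mul_left_eq_zero hs, ← map_mul, h0, map_zero]

theorem finiteLeftUniformDim (h : IsLeftOrder S φ) [IsSemisimpleRing Q]
    (hφ : Function.Injective φ) : FiniteLeftUniformDim R := by
  obtain ⟨s, hind, hsup, hsimple⟩ := IsSemisimpleModule.exists_sSupIndep_sSup_simples_eq_top Q Q
  have hatom : ∀ T : s, IsAtom T.1 := fun T => isSimpleModule_iff_isAtom.1 (hsimple T.1 T.2)
  have hind' : iSupIndep fun T : s => T.1 := (sSupIndep_iff _).1 hind
  have := WellFoundedGT.finite_of_iSupIndep hind' fun T => (hatom T).1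
  let e := Finite.equivFin s
  let T : Fin (Nat.card s) → Ideal Q := fun i => (e.symm i).1
  have hTind : iSupIndep T := hind'.comp e.symm.injective
  have hTsup : ⨆ i, T i = ⊤ := by
    rw [← hsup, sSup_eq_iSup']
    exact e.symm.iSup_comp (g := fun T : s => T.1)
  refine ⟨_, fun i => (T i).comap φ, fun i => h.isUniform_comap hφ (hatom _), fun i => ?_, ?_⟩
  · rw [Submodule.disjoint_def]
    intro x hx hx'
    have hle : ⨆ j, ⨆ (_ : j ≠ i), (T j).comap φ ≤ (⨆ j, ⨆ (_ : j ≠ i), T j).comap φ :=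
      iSup₂_le fun j hj => Ideal.comap_mono (le_iSup₂_of_le j hj le_rfl)
    exact hφ (by rw [map_zero]; exact Submodule.disjoint_def.1 (hTind i) (φ x) hx (hle hx'))
  -- The extra factor `p` is what makes the induction pass sums: the second summand is treated with
  -- `φ s * p`, which produces a common denominator.
  · have key : ∀ q ∈ ⨆ i, T i, ∀ p : Q, ∃ s ∈ S, ∃ r ∈ ⨆ i, (T i).comap φ,
        φ s * (p * q) = φ r := by
      intro q hq
      induction hq using Submodule.iSup_induction' with
      | mem i q hq =>
        intro p
        obtain ⟨s, hs, r, e⟩ := h.exists_mul_eq (p * q)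
        refine ⟨s, hs, r, Submodule.mem_iSup_of_mem i ?_, e⟩
        rw [Ideal.mem_comap, ← e]
        exact Ideal.mul_mem_left _ _ (Ideal.mul_mem_left _ _ hq)
      | zero => exact fun p => ⟨1, S.one_mem, 0, zero_mem _, by simp⟩
      | add x y _ _ hx hy =>
        intro p
        obtain ⟨s, hs, r, hr, e⟩ := hx p
        obtain ⟨s', hs', r', hr', e'⟩ := hy (φ s * p)
        refine ⟨s' * s, S.mul_mem hs' hs, s' * r + r',
          add_mem (Ideal.mul_mem_left _ _ hr) hr', ?_⟩
        rw [map_add, map_mul, map_mul, ← e, ← e']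
        noncomm_ring
    rw [isEssentialLeftIdeal_iff]
    intro x hx
    obtain ⟨s, hs, r, hr, e⟩ := key (φ x) (hTsup ▸ Submodule.mem_top) 1
    have hsx : s * x = r := hφ (by rw [map_mul, ← e, one_mul])
    refine ⟨s, hsx ▸ hr, fun h0 => hx (hφ ?_)⟩
    rw [map_zero, ← h.mul_left_eq_zero hs, ← map_mul, h0, map_zero]

theorem isLeftGoldie_quotient_ker (h : IsLeftOrder S φ) [IsSemisimpleRing Q] :
    IsLeftGoldie (TwoSidedIdeal.ker φ).ringCon.Quotient := by
  let ψ : (TwoSidedIdeal.ker φ).ringCon.Quotient →+* Q := RingCon.lift _ φ le_rfl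
  have hψ : Function.Injective ψ := by
    rw [injective_iff_map_eq_zero, (RingCon.mk'_surjective _).forall]
    intro x hx
    exact mk'_eq_zero.2 ((TwoSidedIdeal.mem_ker φ).2 hx)
  have h' : IsLeftOrder (S.map (TwoSidedIdeal.ker φ).ringCon.mk') ψ := of_comp h
  exact ⟨.of_injective hψ, h'.finiteLeftUniformDim hψ⟩

theorem exists_simple_quotients (h : IsLeftOrder S φ) [IsSemisimpleRing Q] :
    ∃ (n : ℕ) (P : Fin n → TwoSidedIdeal R), (∀ i, IsPrimeIdeal (P i)) ∧
      (∀ i, IsLeftGoldie (P i).ringCon.Quotient) ∧ ∀ x, φ x = 0 ↔ ∀ i, x ∈ P i := by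
  obtain ⟨n, D, d, _, hd, ⟨e⟩⟩ := IsSemisimpleRing.exists_ringEquiv_pi_matrix_divisionRing Q
  let ψ : ∀ i, Q →+* Matrix (Fin (d i)) (Fin (d i)) (D i) :=
    fun i => (Pi.evalRingHom _ i).comp e.toRingHom
  have hψ : ∀ i, Function.Surjective (ψ i) := fun i =>
    (Function.surjective_eval i).comp e.surjective
  have hord : ∀ i, IsLeftOrder S ((ψ i).comp φ) := fun i => h.comp_surjective (hψ i)
  have hss : ∀ i, IsSemisimpleRing (Matrix (Fin (d i)) (Fin (d i)) (D i)) := fun i =>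
    RingHom.isSemisimpleRing_of_surjective (ψ i) (hψ i)
  refine ⟨n, fun i => TwoSidedIdeal.ker ((ψ i).comp φ), fun i => (hord i).isPrimeIdeal_ker,
    fun i => (hord i).isLeftGoldie_quotient_ker, fun x => ?_⟩
  simp only [TwoSidedIdeal.mem_ker]
  rw [← map_eq_zero_iff e e.injective, funext_iff]
  rfl

/-- For `K` maximal among left ideals disjoint from `L`, the sum `L ⊔ K` is essential. Its preimage
is essential modulo `ker φ`, so it meets `S`, and `L ⊔ K` contains a unit. -/
theorem isSemisimpleRing (h : IsLeftOrder S φ)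
    (hS : ∀ J : Ideal R, (∀ r, φ r ≠ 0 → ∃ t, t * r ∈ J ∧ φ (t * r) ≠ 0) → ∃ s ∈ S, s ∈ J) :
    IsSemisimpleRing Q := by
  refine (isSemisimpleModule_iff Q Q).2 ⟨fun L => ?_⟩
  obtain ⟨K, -, hK⟩ := zorn_le_nonempty₀ {K : Ideal Q | Disjoint L K}
    (fun c hc hchain y hy => ⟨sSup c, (hchain.directedOn.disjoint_sSup_right).2
      fun K hK => hc hK, fun K hK => le_sSup hK⟩) ⊥ disjoint_bot_right
  refine ⟨K, hK.1, codisjoint_iff.2 ?_⟩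
  obtain ⟨s, hs, hsJ⟩ := hS (Ideal.comap φ (L ⊔ K : Ideal Q)) (fun r hr => by
    have hne : Ideal.span {φ r} ⊓ (L ⊔ K) ≠ ⊥ := fun hbot => by
      have hd : Disjoint L (K ⊔ Ideal.span {φ r}) :=
        hK.1.disjoint_sup_right_of_disjoint_sup_left (disjoint_iff.2 hbot).symm
      have hle : Ideal.span {φ r} ≤ L ⊔ K :=
        le_sup_right.trans ((hK.2 hd le_sup_left).trans le_sup_right)
      rw [inf_eq_left.2 hle, Ideal.span_singleton_eq_bot] at hbot
      exact hr hbot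
    obtain ⟨x, ⟨hx, hxE⟩, hx0⟩ := Submodule.exists_mem_ne_zero_of_ne_bot hne
    obtain ⟨q, rfl⟩ := Ideal.mem_span_singleton'.1 hx
    obtain ⟨s, hs, t, e⟩ := h.exists_mul_eq q
    refine ⟨t, ?_, ?_⟩
    · rw [Ideal.mem_comap, map_mul, ← e, mul_assoc]
      exact Ideal.mul_mem_left _ _ hxE
    · rwa [map_mul, ← e, mul_assoc, Ne, h.mul_left_eq_zero hs])
  exact Ideal.eq_top_of_isUnit_mem _ hsJ (h.isUnit s hs)

end IsLeftOrder

end LeftOrders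

/-! ### The left quotient ring as a left order. -/

section LeftQuotientRing

variable {R : Type*} [Ring R] {S : Submonoid R}

/-- The canonical map from `R` to `S⁻¹R`. -/
noncomputable def toLeftQuotientRing (h : IsLeftDenominatorSet S) : R →+* LeftQuotientRing h :=
  letI := h.oreSet
  (OreLocalization.numeratorRingHom : R →+* OreLocalization S R)

theorem isLeftOrder_toLeftQuotientRing (h : IsLeftDenominatorSet S) :
    IsLeftOrder S (toLeftQuotientRing h) where
  isUnit s hs := by
    let _ := h.oreSet
    exact OreLocalization.numerator_isUnit (⟨s, hs⟩ : S)
  exists_mul_eq := by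
    let _ := h.oreSet
    intro (q : OreLocalization S R)
    induction q using OreLocalization.ind with
    | _ r s => exact ⟨s, s.2, r, OreLocalization.mul_cancel⟩

theorem toLeftQuotientRing_eq_zero (h : IsLeftDenominatorSet S) {r : R} :
    toLeftQuotientRing h r = 0 ↔ r ∈ ass S := by
  let _ := h.oreSet
  constructor
  · intro h0
    have h1 : (r /ₒ (1 : S) : OreLocalization S R) = 0 /ₒ (1 : S) := by
      rw [OreLocalization.zero_oreDiv]; exact h0
    obtain ⟨u, v, h2, h3⟩ := OreLocalization.oreDiv_eq_iff.1 h1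
    have h4 : (u : R) = v := by simpa using h3
    refine ⟨u, u.2, ?_⟩
    rw [h4]
    simpa [Submonoid.smul_def] using h2.symm
  · rintro ⟨s, hs, e⟩
    rw [← (isLeftOrder_toLeftQuotientRing h).mul_left_eq_zero hs, ← map_mul, e, map_zero]

end LeftQuotientRing

/-! ### The two implications. -/

section Main

variable {R : Type*} [Ring R]

theorem isDenseSubset_map_of_isLeftOrder {Q : Type*} [Ring Q] [IsSemisimpleRing Q] {S : Submonoid R}
    {φ : R →+* Q} (h : IsLeftOrder S φ) (hφ : φ 1 ≠ 0) :
    IsDenseSubset (S.map (TwoSidedIdeal.ker φ).ringCon.mk')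
      (nonZeroDivisors (TwoSidedIdeal.ker φ).ringCon.Quotient) := by
  have hdense : ∀ t ∈ nonZeroDivisors (TwoSidedIdeal.ker φ).ringCon.Quotient,
      ∃ r, r * t ∈ S.map (TwoSidedIdeal.ker φ).ringCon.mk' := by
    rw [(RingCon.mk'_surjective _).forall]
    intro c hc
    have hreg := (mk'_mem_nonZeroDivisors.1 hc).2
    have hinj : Function.Injective (LinearMap.toSpanSingleton Q Q (φ c)) := by
      rw [injective_iff_map_eq_zero]
      intro q hq
      obtain ⟨s, hs, x, e⟩ := h.exists_mul_eq q
      have hq' : q * φ c = 0 := hq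
      have hx : x ∈ TwoSidedIdeal.ker φ := hreg x (by
        rw [TwoSidedIdeal.mem_ker, map_mul, ← e, mul_assoc, hq', mul_zero])
      rwa [TwoSidedIdeal.mem_ker, ← e, h.mul_left_eq_zero hs] at hx
    -- Right multiplication by `φ c` is an injective endomorphism of an Artinian module, so `1` is
    -- in its image.
    obtain ⟨q, hq⟩ := IsArtinian.surjective_of_injective_endomorphism _ hinj 1
    have hq' : q * φ c = 1 := hq
    obtain ⟨s, hs, t, e⟩ := h.exists_mul_eq q
    refine ⟨(TwoSidedIdeal.ker φ).ringCon.mk' t, s, hs, ?_⟩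
    rw [← map_mul, ← sub_eq_zero, ← map_sub]
    refine mk'_eq_zero.2 ((TwoSidedIdeal.mem_ker φ).2 ?_)
    rw [map_sub, map_mul, ← e, mul_assoc, hq', mul_one, sub_self]
  have hzero : (0 : (TwoSidedIdeal.ker φ).ringCon.Quotient) ∉
      S.map (TwoSidedIdeal.ker φ).ringCon.mk' := by
    rintro ⟨s, hs, e⟩
    have h0 : φ s = 0 := (TwoSidedIdeal.mem_ker φ).1 (mk'_eq_zero.1 e)
    refine hφ ((h.mul_left_eq_zero hs).1 ?_)
    rw [h0, zero_mul]
  refine ⟨hzero, fun h0 => ?_, ?_, hdense⟩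
  · obtain ⟨r, hr⟩ := hdense 0 h0
    exact hzero (by rwa [mul_zero] at hr)
  · rintro _ ⟨s, hs, rfl⟩
    refine mk'_mem_nonZeroDivisors.2 ⟨fun x hx => ?_, fun x hx => ?_⟩ <;>
      rw [TwoSidedIdeal.mem_ker, map_mul] at hx <;> rw [TwoSidedIdeal.mem_ker]
    · exact (h.mul_left_eq_zero hs).1 hx
    · exact (h.isUnit s hs).mul_left_eq_zero.1 hx

/-- The kernel is a finite intersection of primes `P i`. A minimal prime over it contains some `P
i`, since otherwise an element outside it would lie in every `P i`; minimality then forces equality.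
-/
theorem isGoldieSemiprime_ker_of_isLeftOrder {Q : Type*} [Ring Q] [IsSemisimpleRing Q]
    {S : Submonoid R} {φ : R →+* Q} (h : IsLeftOrder S φ) :
    IsGoldieSemiprime (TwoSidedIdeal.ker φ) := by
  obtain ⟨n, P, hP, hG, hker⟩ := h.exists_simple_quotients
  have hmem : ∀ x, x ∈ TwoSidedIdeal.ker φ ↔ ∀ i, x ∈ P i :=
    fun x => (TwoSidedIdeal.mem_ker φ).trans (hker x)
  have hmin : ∀ M ∈ minPrimes (TwoSidedIdeal.ker φ), ∃ i, P i = M := by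
    intro M hM
    by_contra! hne
    obtain ⟨x, hxM, hx⟩ := hM.1.1.exists_notMem_of_forall_not_le (Q := P) Finset.univ
      fun i _ hle => hne i (hle.antisymm
        (hM.2 ⟨hP i, fun x hx => (hmem x).1 hx i⟩ hle))
    exact hxM (hM.1.2 ((hmem x).2 fun i => hx i (Finset.mem_univ i)))
  refine ⟨fun A hA x hx => (hmem x).2 fun i => ?_, (Set.finite_range P).subset hmin, fun M hM => ?_⟩
  · exact or_self_iff.1 ((hP i).le_or_le A A fun a ha b hb => (hmem _).1 (hA a ha b hb) i) hx
  · obtain ⟨i, rfl⟩ := hmin M hM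
    exact hG i

variable {a : TwoSidedIdeal R}

theorem IsDenseSubset.exists_sub_mem {S : Submonoid R}
    (hD : IsDenseSubset (S.map a.ringCon.mk') (nonZeroDivisors a.ringCon.Quotient)) {c : R}
    (hc : (∀ x, c * x ∈ a → x ∈ a) ∧ ∀ x, x * c ∈ a → x ∈ a) :
    ∃ s ∈ S, ∃ r, s - r * c ∈ a := by
  obtain ⟨r, s, hs, e⟩ := hD.dense _ (mk'_mem_nonZeroDivisors.2 hc)
  obtain ⟨r, rfl⟩ := a.ringCon.mk'_surjective r
  exact ⟨s, hs, r, mk'_eq_zero.1 (by rw [map_sub, map_mul, e, sub_self])⟩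

theorem IsGoldieSemiprime.isLeftDenominatorSet (hI : IsGoldieSemiprime a)
    (ha : (a : Set R) = ass (nonZeroDivisorsRight R))
    (hD : IsDenseSubset ((nonZeroDivisorsRight R).map a.ringCon.mk')
      (nonZeroDivisors a.ringCon.Quotient)) :
    IsLeftDenominatorSet (nonZeroDivisorsRight R) where
  zero_notMem h0 := hD.zero_notMem_left ⟨0, h0, map_zero _⟩
  ore r s hs := by
    have hreg := mk'_mem_nonZeroDivisors.1 (hD.le ⟨s, hs, rfl⟩)
    obtain ⟨d, y, hd, hdy⟩ := hI.exists_regular_mul_sub_mem hreg.2 r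
    obtain ⟨s', hs', w, hw⟩ := hD.exists_sub_mem hd
    have h1 : s' * r - w * y * s ∈ a := by
      have e : s' * r - w * y * s = (s' - w * d) * r + w * (d * r - y * s) := by noncomm_ring
      rw [e]
      exact a.add_mem (a.mul_mem_right _ _ hw) (a.mul_mem_left _ _ hdy)
    -- The Ore equation holds modulo `a`; since `a = ass S`, left multiplication by a left regular
    -- `t` makes it exact.
    obtain ⟨t, ht, h2⟩ : s' * r - w * y * s ∈ ass (nonZeroDivisorsRight R) := ha ▸ h1
    refine ⟨t * (w * y), t * s', mul_mem ht hs', ?_⟩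
    rw [mul_sub, sub_eq_zero] at h2
    rw [mul_assoc, h2, ← mul_assoc]
  reversible r s hs hrs := ⟨1, one_mem _, by rw [hs r hrs, mul_zero]⟩

theorem IsGoldieSemiprime.isSemisimpleRing_leftQuotientRing (hI : IsGoldieSemiprime a)
    {S : Submonoid R} (ha : (a : Set R) = ass S)
    (hD : IsDenseSubset (S.map a.ringCon.mk') (nonZeroDivisors a.ringCon.Quotient))
    (h : IsLeftDenominatorSet S) : IsSemisimpleRing (LeftQuotientRing h) := by
  have hφ : ∀ r, toLeftQuotientRing h r ≠ 0 ↔ r ∉ a := fun r => by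
    rw [Ne, toLeftQuotientRing_eq_zero, ← ha, SetLike.mem_coe]
  refine (isLeftOrder_toLeftQuotientRing h).isSemisimpleRing fun J hJ => ?_
  simp only [hφ] at hJ
  obtain ⟨c, hcJ, hc⟩ := hI.exists_mem_regular hJ
  obtain ⟨s, hs, r, hr⟩ := hD.exists_sub_mem hc
  obtain ⟨t, ht, e⟩ : s - r * c ∈ ass S := ha ▸ hr
  rw [mul_sub, sub_eq_zero] at e
  exact ⟨t * s, S.mul_mem ht hs, e ▸ J.mul_mem_left t (J.mul_mem_left r hcJ)⟩

end Main

end LeftQuot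

theorem mainTheorem7 {R : Type*} [Ring R] :
    (∃ h : LeftQuot.IsLeftDenominatorSet (nonZeroDivisorsRight R),
        IsSemisimpleRing (LeftQuot.LeftQuotientRing h)) ↔
      ∃ a : TwoSidedIdeal R,
        (a : Set R) = LeftQuot.ass (nonZeroDivisorsRight R) ∧
        (LeftQuot.IsSemiprimeIdeal a ∧ (LeftQuot.minPrimes a).Finite) ∧
        (∀ P ∈ LeftQuot.minPrimes a, LeftQuot.IsLeftGoldie P.ringCon.Quotient) ∧
        LeftQuot.IsDenseSubset ((nonZeroDivisorsRight R).map a.ringCon.mk')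
          (nonZeroDivisors a.ringCon.Quotient) := by
  constructor
  · rintro ⟨h, hss⟩
    have hord := LeftQuot.isLeftOrder_toLeftQuotientRing h
    have hI := LeftQuot.isGoldieSemiprime_ker_of_isLeftOrder hord
    refine ⟨TwoSidedIdeal.ker (LeftQuot.toLeftQuotientRing h), ?_, ⟨hI.semiprime, hI.finite⟩,
      hI.goldie, LeftQuot.isDenseSubset_map_of_isLeftOrder hord fun h1 => ?_⟩
    · ext r
      rw [SetLike.mem_coe, TwoSidedIdeal.mem_ker, LeftQuot.toLeftQuotientRing_eq_zero]
    · obtain ⟨t, ht, e⟩ := (LeftQuot.toLeftQuotientRing_eq_zero h).1 h1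
      rw [mul_one] at e
      exact h.zero_notMem (e ▸ ht)
  · rintro ⟨a, ha, ⟨hsp, hfin⟩, hG, hD⟩
    have hI : LeftQuot.IsGoldieSemiprime a := ⟨hsp, hfin, hG⟩
    have h := hI.isLeftDenominatorSet ha hD
    exact ⟨h, hI.isSemisimpleRing_leftQuotientRing ha hD h⟩
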